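/- Call a function $\Phi:\mathbb R\to\mathbb C$ positive definite if it is continuous and, for every finite family of points $x_1,\dots,x_n\in\mathbb R$, the matrix $[\Phi(x_i-x_j)]_{i,j}$ is positive semi-definite (Hermitian with non-negative eigenvalues). Let $f:\mathbb R\to\mathbb C$ be a function such that (i) $f\in L^2(\mathbb R)+\mathbb C\,1$, that is, $f-k\in L^2(\mathbb R)$ for some constant $k\in\mathbb C$; (ii) $|f|$ is bounded and bounded away from zero; (iii) $f^\lambda$ is positive definite for all real $\lambda>0$, where $f^\lambda:=\exp(\lambda g)$ for some fixed function $g:\mathbb R\to\mathbb C$ with $e^{g}=f$ (a branch of $\log f$). Then $f$ is positive definite if and only if there exist positive definite functions $\Phi_+$ and $\Phi_-$ such that $f=\Phi_+\Phi_-$. Moreover, if $f$ is positive definite, the positive definite factors $\Phi_\pm$ can be chosen so that $\Phi_+$ extends to a bounded holomorphic function on the upper half plane and $\Phi_-$ extends to a bounded holomorphic function on the lower half plane; here "extends" means that there is a bounded continuous function on the closed half plane, holomorphic in the open half plane, that coincides with the factor on $\mathbb R$. -/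

import Mathlib

open MeasureTheory
open scoped ComplexOrder

/-- A positive definite function on the real line, in the sense of Bochner's theorem: a continuous
function all of whose matrices `[f (x i - x j)]` are positive semi-definite
(Hermitian with non-negative eigenvalues). -/
def IsPositiveDefiniteFun (f : ℝ → ℂ) : Prop :=
  Continuous f ∧
    ∀ (n : ℕ) (x : Fin n → ℝ),
      (Matrix.of fun i j : Fin n => f (x i - x j)).PosSemidef

/-- `f ∈ L²(ℝ) + ℂ·1`. -/
def MemL2AddConst (f : ℝ → ℂ) : Prop :=
  ∃ k : ℂ, MemLp (fun x => f x - k) 2 volume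

/-- `Φ` extends to a bounded holomorphic function on the upper half plane: there is a bounded
continuous function on the closed upper half plane, holomorphic in the open one, whose
values on the real line are those of `Φ`. -/
def ExtendsBoundedHolomorphicUpper (Φ : ℝ → ℂ) : Prop :=
  ∃ F : ℂ → ℂ,
    DifferentiableOn ℂ F {z : ℂ | 0 < z.im} ∧
    ContinuousOn F {z : ℂ | 0 ≤ z.im} ∧
    (∃ M : ℝ, ∀ z : ℂ, 0 ≤ z.im → ‖F z‖ ≤ M) ∧
    ∀ x : ℝ, F (x : ℂ) = Φ x

/-- `Φ` extends to a bounded holomorphic function on the lower half plane, with boundary values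
understood as for the upper half plane. -/
def ExtendsBoundedHolomorphicLower (Φ : ℝ → ℂ) : Prop :=
  ∃ F : ℂ → ℂ,
    DifferentiableOn ℂ F {z : ℂ | z.im < 0} ∧
    ContinuousOn F {z : ℂ | z.im ≤ 0} ∧
    (∃ M : ℝ, ∀ z : ℂ, z.im ≤ 0 → ‖F z‖ ≤ M) ∧
    ∀ x : ℝ, F (x : ℂ) = Φ x

/-! The equivalence is cheap: take `1` as second factor, and conversely use Schur's product theorem.
The content is the factorization across half planes, which is the splitting of a Lévy-Khintchine
type exponent. By Krein's inequality `f` is uniformly continuous, so `f - k ∈ L²` forces `f → k` at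
infinity, and `k ≠ 0` since `|f|` is bounded below. Hence `g` is continuous and has a limit `l` at
`+∞`. Removing from `exp (r g)` the mean of its limits at `±∞` keeps it positive definite
(`sub_half_add_limits`); dividing by `r` and letting `r → 0+` shows that `g - Re l` is positive
definite (`exists_sub_const`). By Bochner, `g - Re l` is the characteristic function of a finite
measure `μ`. The parts of `μ` on `[0, ∞)` and `(-∞, 0)` have transforms extending to the upper and
lower half planes, and their exponentials are the factors, up to the constant `exp (Re l)`. -/

open Filter Topology ProbabilityTheory
open scoped ComplexConjugate Matrix NNReal ENNReal

/-! ### Elementary theory of positive definite functions. -/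

namespace IsPositiveDefiniteFun

variable {φ ψ : ℝ → ℂ}

theorem posSemidef {ι : Type*} [Fintype ι] (hφ : IsPositiveDefiniteFun φ) (x : ι → ℝ) :
    (Matrix.of fun i j : ι => φ (x i - x j)).PosSemidef := by
  have h := (hφ.2 (Fintype.card ι) (x ∘ (Fintype.equivFin ι).symm)).submatrix (Fintype.equivFin ι)
  convert h using 1
  ext i j
  simp

theorem sum_nonneg {ι : Type*} [Fintype ι] (hφ : IsPositiveDefiniteFun φ) (x : ι → ℝ)
    (c : ι → ℂ) : 0 ≤ ∑ i, ∑ j, conj (c i) * φ (x i - x j) * c j := by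
  have h := (hφ.posSemidef x).dotProduct_mulVec_nonneg c
  simpa [dotProduct, Matrix.mulVec, Finset.mul_sum, mul_assoc] using h

theorem apply_neg (hφ : IsPositiveDefiniteFun φ) (x : ℝ) : φ (-x) = conj (φ x) := by
  have h := (hφ.posSemidef ![x, 0]).isHermitian.apply 1 0
  simpa using h.symm

theorem of_sum_nonneg (hc : Continuous φ) (hneg : ∀ x, φ (-x) = conj (φ x))
    (h : ∀ (n : ℕ) (x : Fin n → ℝ) (c : Fin n → ℂ),
      0 ≤ ∑ i, ∑ j, conj (c i) * φ (x i - x j) * c j) : IsPositiveDefiniteFun φ := by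
  refine ⟨hc, fun n x => Matrix.PosSemidef.of_dotProduct_mulVec_nonneg ?_ fun c => ?_⟩
  · ext i j
    simp [Matrix.conjTranspose_apply, ← hneg]
  · simpa [dotProduct, Matrix.mulVec, Finset.mul_sum, mul_assoc] using h n x c

theorem apply_zero_nonneg (hφ : IsPositiveDefiniteFun φ) : 0 ≤ φ 0 := by
  simpa using hφ.sum_nonneg (fun _ : Fin 1 => 0) (fun _ => 1)

theorem of_tendsto {α : Type*} {l : Filter α} [l.NeBot] {F : α → ℝ → ℂ}
    (hF : ∀ᶠ a in l, IsPositiveDefiniteFun (F a)) (hφ : Continuous φ)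
    (h : ∀ x, Tendsto (fun a => F a x) l (𝓝 (φ x))) : IsPositiveDefiniteFun φ := by
  refine of_sum_nonneg hφ (fun x => ?_) fun n x c => ?_
  · refine tendsto_nhds_unique (h (-x)) (((Complex.continuous_conj.tendsto _).comp (h x)).congr' ?_)
    filter_upwards [hF] with a ha using (ha.apply_neg x).symm
  · refine ge_of_tendsto (tendsto_finsetSum _ fun i _ => tendsto_finsetSum _ fun j _ =>
      ((h (x i - x j)).const_mul (conj (c i))).mul_const (c j)) ?_
    filter_upwards [hF] with a ha using ha.sum_nonneg x c

theorem mul (hφ : IsPositiveDefiniteFun φ) (hψ : IsPositiveDefiniteFun ψ) :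
    IsPositiveDefiniteFun fun x => φ x * ψ x :=
  ⟨hφ.1.mul hψ.1, fun n x => (hφ.2 n x).hadamard (hψ.2 n x)⟩

theorem add (hφ : IsPositiveDefiniteFun φ) (hψ : IsPositiveDefiniteFun ψ) :
    IsPositiveDefiniteFun fun x => φ x + ψ x :=
  ⟨hφ.1.add hψ.1, fun n x => (hφ.2 n x).add (hψ.2 n x)⟩

theorem const_mul (hφ : IsPositiveDefiniteFun φ) {a : ℂ} (ha : 0 ≤ a) :
    IsPositiveDefiniteFun fun x => a * φ x :=
  ⟨hφ.1.const_mul a, fun n x => (hφ.2 n x).smul ha⟩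

theorem exp_mul_I (t : ℝ) : IsPositiveDefiniteFun fun x : ℝ => Complex.exp (t * x * Complex.I) := by
  refine ⟨by fun_prop, fun n x => ?_⟩
  convert Matrix.posSemidef_vecMulVec_self_star
    (fun i => Complex.exp (t * x i * Complex.I)) using 1
  ext i j
  simp only [Matrix.of_apply, Matrix.vecMulVec_apply, Pi.star_apply, RCLike.star_def,
    ← Complex.exp_conj, ← Complex.exp_add]
  congr 1
  simp
  ring

theorem one : IsPositiveDefiniteFun fun _ => 1 := by
  simpa using exp_mul_I 0

theorem const {a : ℂ} (ha : 0 ≤ a) : IsPositiveDefiniteFun fun _ => a := by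
  simpa using one.const_mul ha

theorem pow (hφ : IsPositiveDefiniteFun φ) (n : ℕ) : IsPositiveDefiniteFun fun x => φ x ^ n := by
  induction n with
  | zero => simpa using one
  | succ n ih => simpa only [pow_succ] using ih.mul hφ

theorem exp (hφ : IsPositiveDefiniteFun φ) :
    IsPositiveDefiniteFun fun x => Complex.exp (φ x) := by
  refine of_tendsto (l := atTop) (F := fun N x => ∑ n ∈ Finset.range N, (n.factorial : ℂ)⁻¹ * φ x ^ n)
    (Eventually.of_forall fun N => ?_) (Complex.continuous_exp.comp hφ.1) fun x => ?_
  · induction N with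
    | zero => simpa using const le_rfl
    | succ N ih =>
      simp only [Finset.sum_range_succ]
      exact ih.add ((hφ.pow N).const_mul (inv_nonneg.2 (Nat.cast_nonneg _)))
  · have := (NormedSpace.expSeries_div_hasSum_exp (φ x)).tendsto_sum_nat
    rw [← Complex.exp_eq_exp_ℂ] at this
    simpa [div_eq_inv_mul] using this

theorem charFun (μ : Measure ℝ) [IsFiniteMeasure μ] : IsPositiveDefiniteFun (charFun μ) := by
  refine of_sum_nonneg (by fun_prop) (fun x => charFun_neg x) fun n x c => ?_
  have hint (u : ℝ) : Integrable (fun t : ℝ => Complex.exp (u * t * Complex.I)) μ := by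
    refine Integrable.of_bound (by fun_prop) 1 (ae_of_all _ fun t => ?_)
    rw [← Complex.ofReal_mul, Complex.norm_exp_ofReal_mul_I]
  have : ∑ i, ∑ j, conj (c i) * MeasureTheory.charFun μ (x i - x j) * c j =
      ∫ t, ∑ i, ∑ j, conj (c i) * Complex.exp ((x i - x j : ℝ) * t * Complex.I) * c j ∂μ := by
    rw [integral_finsetSum _ fun i _ => integrable_finsetSum _ fun j _ =>
      ((hint _).const_mul _).mul_const _]
    refine Finset.sum_congr rfl fun i _ => ?_
    rw [integral_finsetSum _ fun j _ => ((hint _).const_mul _).mul_const _]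
    refine Finset.sum_congr rfl fun j _ => ?_
    rw [integral_mul_const, integral_const_mul, charFun_apply_real]
  rw [this]
  refine integral_nonneg fun t => ?_
  change (0 : ℂ) ≤ _
  simpa only [mul_comm] using (exp_mul_I t).sum_nonneg x c

/-- Discriminant argument, with `D = |z|²` and test coefficient `-s * conj z` in the two uses below.
The choice `s = 1 / a` is optimal; for `a = 0` a large `s` excludes `D > 0`. -/
theorem le_mul_of_forall_quadratic_nonneg {a b D : ℝ} (ha : 0 ≤ a)
    (h : ∀ s : ℝ, 0 ≤ b + s ^ 2 * D * a - 2 * s * D) : D ≤ a * b := by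
  rcases ha.eq_or_lt with rfl | ha
  · by_contra! hD
    rw [zero_mul] at hD
    have := h ((1 + b) / (2 * D))
    field_simp at this
    linarith
  · have := h a⁻¹
    field_simp at this
    linarith

theorem norm_le (hφ : IsPositiveDefiniteFun φ) (x : ℝ) : ‖φ x‖ ≤ (φ 0).re := by
  have h0 := Complex.nonneg_iff.1 hφ.apply_zero_nonneg
  refine le_of_sq_le_sq ?_ h0.1
  rw [sq (φ 0).re]
  refine le_mul_of_forall_quadratic_nonneg h0.1 fun s => ?_
  have h := (Complex.nonneg_iff.1 (hφ.sum_nonneg ![x, 0] ![1, -s * conj (φ x)])).1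
  simp [hφ.apply_neg x, ← h0.2] at h
  rw [← Complex.normSq_eq_norm_sq, Complex.normSq_apply]
  linarith

/-- Krein's inequality. -/
theorem norm_sub_sq_le (hφ : IsPositiveDefiniteFun φ) (x y : ℝ) :
    ‖φ x - φ y‖ ^ 2 ≤ (φ 0).re * (2 * (φ 0).re - 2 * (φ (x - y)).re) := by
  have h0 := Complex.nonneg_iff.1 hφ.apply_zero_nonneg
  refine le_mul_of_forall_quadratic_nonneg h0.1 fun s => ?_
  have h := (Complex.nonneg_iff.1
    (hφ.sum_nonneg ![x, y, 0] ![1, -1, -s * conj (φ x - φ y)])).1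
  have hxy : φ (y - x) = conj (φ (x - y)) := by rw [← hφ.apply_neg, neg_sub]
  simp [Fin.sum_univ_three, hφ.apply_neg x, hφ.apply_neg y, hxy, ← h0.2] at h
  rw [← Complex.normSq_eq_norm_sq, Complex.normSq_apply]
  simp
  linarith

theorem uniformContinuous (hφ : IsPositiveDefiniteFun φ) : UniformContinuous φ := by
  rw [Metric.uniformContinuous_iff]
  intro ε hε
  have hlim : Tendsto (fun u => (φ 0).re * (2 * (φ 0).re - 2 * (φ u).re)) (𝓝 0) (𝓝 0) := by
    have : Continuous fun u => (φ 0).re * (2 * (φ 0).re - 2 * (φ u).re) := by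
      have := hφ.1
      fun_prop
    simpa using this.tendsto 0
  obtain ⟨δ, hδ, h⟩ := Metric.eventually_nhds_iff.1 (hlim.eventually_lt_const (pow_pos hε 2))
  refine ⟨δ, hδ, fun {x y} hxy => ?_⟩
  rw [dist_eq_norm]
  refine lt_of_pow_lt_pow_left₀ 2 hε.le ((hφ.norm_sub_sq_le x y).trans_lt (h ?_))
  rwa [dist_zero_right, ← dist_eq_norm]

/-- If a positive definite function has limits at `±∞`, subtracting their mean leaves it positive
definite. -/
theorem sub_half_add_limits (hφ : IsPositiveDefiniteFun φ) {a b : ℂ}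
    (ha : Tendsto φ atTop (𝓝 a)) (hb : Tendsto φ atBot (𝓝 b)) :
    IsPositiveDefiniteFun fun x => φ x - (a + b) / 2 := by
  have hab : b = conj a := by
    refine tendsto_nhds_unique (hb.comp tendsto_neg_atTop_atBot) ?_
    refine ((Complex.continuous_conj.tendsto _).comp ha).congr fun x => ?_
    exact (hφ.apply_neg x).symm
  refine of_sum_nonneg (hφ.1.sub continuous_const) (fun x => ?_) fun n x c => ?_
  · simp [hφ.apply_neg, hab, add_comm, Complex.conj_ofNat]
  -- Double the points to `x i` and `x i + T` with coefficients `c` and `-c`: the diagonal blocks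
  -- give `2 φ`, the cross blocks the translates by `±T`, which tend to `a` and `b`.
  · have key (T : ℝ) : 0 ≤ ∑ i, ∑ j, conj (c i) *
        (φ (x i - x j) - (φ (x i - x j + T) + φ (x i - x j - T)) / 2) * c j := by
      have h := hφ.sum_nonneg (Sum.elim x fun i => x i + T) (Sum.elim c (-c))
      have h2 := mul_nonneg (show (0 : ℂ) ≤ 1 / 2 by positivity) h
      convert h2 using 1
      simp only [Fintype.sum_sum_type, Sum.elim_inl, Sum.elim_inr, Finset.mul_sum,
        ← Finset.sum_add_distrib]
      refine Finset.sum_congr rfl fun i _ => Finset.sum_congr rfl fun j _ => ?_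
      rw [show x i + T - (x j + T) = x i - x j by ring,
        show x i + T - x j = x i - x j + T by ring, show x i - (x j + T) = x i - x j - T by ring]
      simp
      ring
    refine ge_of_tendsto' (tendsto_finsetSum _ fun i _ => tendsto_finsetSum _ fun j _ =>
      (((tendsto_const_nhds (x := φ (x i - x j))).sub (((ha.comp
        (tendsto_atTop_add_const_left atTop (x i - x j) tendsto_id)).add (hb.comp
        (tendsto_atBot_add_const_left atTop (x i - x j) tendsto_neg_atTop_atBot))).div_const 2)).const_mul
          (conj (c i))).mul_const (c j)) fun T => ?_
    simpa [sub_eq_add_neg] using key T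

end IsPositiveDefiniteFun

/-! ### Bochner's theorem on the line. -/

section Bochner

open FourierTransform

/-- Multiplication formula for the Fourier transform against a Gaussian. -/
theorem integral_exp_mul_fourier {ψ : ℝ → ℂ} (hψ : Integrable ψ) {c : ℝ} (hc : 0 < c) :
    ∫ w : ℝ, Complex.exp (-c⁻¹ * ‖w‖ ^ 2) * 𝓕 ψ w =
      ∫ w : ℝ, ((Real.pi * c : ℂ) ^ (Module.finrank ℝ ℝ / 2 : ℂ) *
        Complex.exp (-Real.pi ^ 2 * c * ‖0 - w‖ ^ 2)) • ψ w := by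
  have J : Integrable (fun w : ℝ =>
      Complex.exp (- c⁻¹ * ‖w‖ ^ 2 + 2 * Real.pi * Complex.I * inner ℝ (0 : ℝ) w)) :=
    GaussianFourier.integrable_cexp_neg_mul_sq_norm_add (by simpa) _ _
  have h := (VectorFourier.integral_fourierIntegral_smul_eq_flip (L := innerₗ ℝ)
      Real.continuous_fourierChar continuous_inner J hψ).symm
  have h2 : ∫ w : ℝ, Complex.exp (- c⁻¹ * ‖w‖ ^ 2 +
      2 * Real.pi * Complex.I * inner ℝ (0 : ℝ) w) • 𝓕 ψ w =
      ∫ w : ℝ, 𝓕 (fun w : ℝ => Complex.exp (- c⁻¹ * ‖w‖ ^ 2 +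
        2 * Real.pi * Complex.I * inner ℝ (0 : ℝ) w)) w • ψ w := by
    simpa using! h
  convert h2 using 1
  · simp
  · refine integral_congr_ae (ae_of_all _ fun w => ?_)
    have h3 : (Real.pi : ℂ) / (c⁻¹ : ℝ) = Real.pi * c := by simp
    have h4 : -(Real.pi : ℂ) ^ 2 * ‖0 - w‖ ^ 2 / (c⁻¹ : ℝ) = -Real.pi ^ 2 * c * ‖0 - w‖ ^ 2 := by
      rw [Complex.ofReal_inv, div_inv_eq_mul]; ring
    have h5 := fourier_gaussian_innerProductSpace' (b := (c⁻¹ : ℝ)) (by simpa) (0 : ℝ) w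
    rw [h3, h4] at h5
    simp only [← h5]

/-- Gaussian-damped integrals of `𝓕 ψ` are Gaussian averages of `ψ`, hence tend to `ψ 0`. As the
integrands are non-negative, Fatou's lemma bounds the undamped integral. -/
theorem integrable_fourier_of_nonneg {ψ : ℝ → ℂ} (hψ : Integrable ψ) (hc : ContinuousAt ψ 0)
    (hpos : ∀ ξ, 0 ≤ 𝓕 ψ ξ) : Integrable (𝓕 ψ) := by
  have hcont : Continuous (𝓕 ψ) :=
    VectorFourier.fourierIntegral_continuous Real.continuous_fourierChar continuous_inner hψ
  have hre (ξ : ℝ) : 𝓕 ψ ξ = ((𝓕 ψ ξ).re : ℂ) := Complex.eq_re_of_ofReal_le (hpos ξ)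
  have hre0 (ξ : ℝ) : 0 ≤ (𝓕 ψ ξ).re := (Complex.nonneg_iff.1 (hpos ξ)).1
  suffices h : Integrable fun ξ => (𝓕 ψ ξ).re from
    (h.ofReal (𝕜 := ℂ)).congr (ae_of_all _ fun ξ => (hre ξ).symm)
  let G : ℕ → ℝ → ℝ := fun n ξ => Real.exp (-((n : ℝ) + 1)⁻¹ * ξ ^ 2) * (𝓕 ψ ξ).re
  have hbound (ξ : ℝ) : ‖𝓕 ψ ξ‖ ≤ ∫ x, ‖ψ x‖ :=
    VectorFourier.norm_fourierIntegral_le_integral_norm _ _ _ _ _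
  have hG (n : ℕ) : Integrable (G n) := by
    have h1 : Integrable fun ξ : ℝ => Real.exp (-((n : ℝ) + 1)⁻¹ * ξ ^ 2) :=
      integrable_exp_neg_mul_sq (by positivity)
    refine h1.mul_bdd (c := ∫ x, ‖ψ x‖) (by fun_prop) (ae_of_all _ fun ξ => ?_)
    exact (Complex.abs_re_le_norm _).trans (hbound ξ)
  have hlim : Tendsto (fun n : ℕ => ∫⁻ ξ, ‖G n ξ‖ₑ) atTop (𝓝 (ENNReal.ofReal (ψ 0).re)) := by
    have h1 := ((Real.tendsto_integral_gaussian_smul' hψ hc).comp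
      (tendsto_atTop_add_const_right _ (1 : ℝ) tendsto_natCast_atTop_atTop))
    refine (ENNReal.tendsto_ofReal ((Complex.continuous_re.tendsto _).comp h1)).congr fun n => ?_
    rw [← ofReal_integral_norm_eq_lintegral_enorm (hG n)]
    simp only [Function.comp_apply]
    congr 1
    have hn : (0 : ℝ) < n + 1 := by positivity
    rw [← integral_exp_mul_fourier hψ hn, ← Complex.ofReal_re (∫ ξ, ‖G n ξ‖), ← integral_complex_ofReal]
    congr 2
    ext ξ
    rw [Real.norm_of_nonneg (mul_nonneg (Real.exp_nonneg _) (hre0 ξ))]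
    push_cast [G]
    rw [← hre ξ]
    simp [← Complex.ofReal_pow]
  refine integrable_of_tendsto (G := G) (ae_of_all _ fun ξ => ?_) (fun n => (hG n).1) ?_
  · have h1 : Tendsto (fun n : ℕ => ((n : ℝ) + 1)⁻¹) atTop (𝓝 0) :=
      tendsto_inv_atTop_zero.comp
        (tendsto_atTop_add_const_right _ (1 : ℝ) tendsto_natCast_atTop_atTop)
    simpa [G, Function.comp_def] using ((Real.continuous_exp.tendsto _).comp (h1.neg.mul_const (ξ ^ 2))).mul_const
      (𝓕 ψ ξ).re
  · rw [hlim.liminf_eq]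
    exact ENNReal.ofReal_ne_top

theorem exists_charFun_eq_of_fourier_nonneg {ψ : ℝ → ℂ} (hψ : Integrable ψ) (hc : Continuous ψ)
    (hpos : ∀ ξ, 0 ≤ 𝓕 ψ ξ) : ∃ μ : Measure ℝ, IsFiniteMeasure μ ∧ charFun μ = ψ := by
  have hint := integrable_fourier_of_nonneg hψ hc.continuousAt hpos
  have hcont : Continuous (𝓕 ψ) :=
    VectorFourier.fourierIntegral_continuous Real.continuous_fourierChar continuous_inner hψ
  have hre (ξ : ℝ) : 𝓕 ψ ξ = ((𝓕 ψ ξ).re : ℂ) := Complex.eq_re_of_ofReal_le (hpos ξ)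
  have hre0 (ξ : ℝ) : 0 ≤ (𝓕 ψ ξ).re := (Complex.nonneg_iff.1 (hpos ξ)).1
  let ρ : Measure ℝ := volume.withDensity fun ξ => ENNReal.ofReal (𝓕 ψ ξ).re
  have hρ : IsFiniteMeasure ρ := isFiniteMeasure_withDensity_ofReal hint.re.2
  -- The dilation reconciles the kernel `exp (2πixξ)` of Fourier inversion with the kernel `exp
  -- (ixt)` of `charFun`.
  refine ⟨ρ.map fun ξ => 2 * Real.pi * ξ, inferInstance, ?_⟩
  ext x
  rw [charFun_map_mul, charFun_apply_real, integral_withDensity_eq_integral_toReal_smul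
    (by fun_prop) (ae_of_all _ fun ξ => ENNReal.ofReal_lt_top)]
  conv_rhs => rw [← hc.fourierInv_fourier_eq hψ hint, Real.fourierInv_eq']
  congr with ξ
  rw [ENNReal.toReal_ofReal (hre0 ξ), Complex.real_smul, ← hre, smul_eq_mul, mul_comm]
  congr 2
  simp
  ring

namespace IsPositiveDefiniteFun

variable {φ : ℝ → ℂ}

theorem integrable (hφ : IsPositiveDefiniteFun φ) {α : Type*} [MeasurableSpace α] (μ : Measure α)
    [IsFiniteMeasure μ] {u : α → ℝ} (hu : Measurable u) : Integrable (fun a => φ (u a)) μ :=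
  Integrable.of_bound (hφ.1.measurable.comp hu).aestronglyMeasurable _
    (ae_of_all _ fun a => hφ.norm_le (u a))

/-- Average the quadratic form over `n + 1` independent points of law `P`: the diagonal contributes
`(n + 1) φ 0`, the rest `(n + 1) n J`. Divide by `(n + 1)²` and let `n → ∞`. -/
theorem integral_sub_prod_nonneg (hφ : IsPositiveDefiniteFun φ) (P : Measure ℝ)
    [IsProbabilityMeasure P] : 0 ≤ ∫ p : ℝ × ℝ, φ (p.1 - p.2) ∂P.prod P := by
  set J := ∫ p : ℝ × ℝ, φ (p.1 - p.2) ∂P.prod P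
  have hmap {n : ℕ} {i j : Fin n} (hij : i ≠ j) :
      (Measure.pi fun _ : Fin n => P).map (fun ω => (ω i, ω j)) = P.prod P := by
    have h := (iIndepFun_pi (μ := fun _ : Fin n => P) (X := fun _ x => x)
      fun _ => aemeasurable_id).indepFun hij
    rw [indepFun_iff_map_prod_eq_prod_map_map (measurable_pi_apply i).aemeasurable
      (measurable_pi_apply j).aemeasurable] at h
    rw [h]
    congr 1
    · exact (measurePreserving_eval (fun _ : Fin n => P) i).map_eq
    · exact (measurePreserving_eval (fun _ : Fin n => P) j).map_eq
  have key (n : ℕ) : 0 ≤ (((n : ℝ) + 1)⁻¹ : ℝ) * φ 0 + ((1 - ((n : ℝ) + 1)⁻¹ : ℝ) : ℂ) * J := by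
    have h1 : 0 ≤ ∫ ω, ∑ i, ∑ j, φ (ω i - ω j) ∂Measure.pi fun _ : Fin (n + 1) => P := by
      refine integral_nonneg fun ω => ?_
      change (0 : ℂ) ≤ _
      simpa using hφ.sum_nonneg ω 1
    have h2 : ∫ ω, ∑ i, ∑ j, φ (ω i - ω j) ∂(Measure.pi fun _ : Fin (n + 1) => P) =
        ((n : ℂ) + 1) * φ 0 + (n + 1) * n * J := by
      have hi (i j : Fin (n + 1)) : Integrable (fun ω : Fin (n + 1) → ℝ => φ (ω i - ω j))
          (Measure.pi fun _ => P) := hφ.integrable _ (by fun_prop)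
      rw [integral_finsetSum _ fun i _ => integrable_finsetSum _ fun j _ => hi i j]
      have h3 (i : Fin (n + 1)) :
          ∫ ω, ∑ j, φ (ω i - ω j) ∂(Measure.pi fun _ : Fin (n + 1) => P) = φ 0 + n * J := by
        rw [integral_finsetSum _ fun j _ => hi i j, ← Finset.add_sum_erase _ _ (Finset.mem_univ i),
          Finset.sum_congr rfl (g := fun _ => J)]
        · simp
        · intro j hj
          simp only [J]
          rw [← hmap (Finset.ne_of_mem_erase hj).symm, integral_map (by fun_prop)]
          exact (hφ.1.comp (by fun_prop)).aestronglyMeasurable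
      simp [h3]
      ring
    rw [h2] at h1
    have hn : (0 : ℂ) ≤ (((n : ℝ) + 1)⁻¹ ^ 2 : ℝ) := by
      rw [Complex.zero_le_real]; positivity
    convert mul_nonneg hn h1 using 1
    have : (n : ℂ) + 1 ≠ 0 := by exact_mod_cast n.succ_ne_zero
    push_cast
    field_simp
    ring
  have h1 : Tendsto (fun n : ℕ => ((n : ℝ) + 1)⁻¹) atTop (𝓝 0) :=
    tendsto_inv_atTop_zero.comp
      (tendsto_atTop_add_const_right _ (1 : ℝ) tendsto_natCast_atTop_atTop)
  have h2 : Tendsto (fun n : ℕ => (((n : ℝ) + 1)⁻¹ : ℝ) * φ 0 +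
      ((1 - ((n : ℝ) + 1)⁻¹ : ℝ) : ℂ) * J) atTop (𝓝 ((0 : ℝ) * φ 0 + ((1 - 0 : ℝ) : ℂ) * J)) :=
    (((Complex.continuous_ofReal.tendsto _).comp h1).mul_const _).add
      (((Complex.continuous_ofReal.tendsto _).comp (h1.const_sub 1)).mul_const _)
  have h3 := ge_of_tendsto' h2 key
  simpa using h3

/-- A centred Gaussian is the law of the difference of two independent centred Gaussians of half the
variance. -/
theorem integral_gaussianReal_nonneg (hφ : IsPositiveDefiniteFun φ) (v : ℝ≥0) :
    0 ≤ ∫ x, φ x ∂gaussianReal 0 v := by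
  have h := hφ.integral_sub_prod_nonneg (gaussianReal 0 (v / 2))
  rw [integral_prod _ (hφ.integrable _ (by fun_prop))] at h
  have h2 : gaussianReal 0 v =
      gaussianReal 0 (v / 2) ∗ (gaussianReal 0 (v / 2)).map fun x => -x := by
    rw [gaussianReal_map_neg, gaussianReal_conv_gaussianReal]
    simp
  rw [h2, integral_conv (show Integrable φ _ from hφ.integrable _ measurable_id)]
  convert h using 3 with x
  rw [integral_map (by fun_prop) (f := fun y => φ (x + y))
    (hφ.1.comp (by fun_prop)).aestronglyMeasurable]
  rfl

theorem exists_charFun_eq_mul_gaussianPDFReal (hφ : IsPositiveDefiniteFun φ) {v : ℝ≥0}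
    (hv : v ≠ 0) : ∃ μ : Measure ℝ, IsFiniteMeasure μ ∧
      MeasureTheory.charFun μ = fun x => (gaussianPDFReal 0 v x : ℂ) * φ x := by
  refine exists_charFun_eq_of_fourier_nonneg ?_ ?_ fun ξ => ?_
  · exact ((integrable_gaussianPDFReal 0 v).ofReal (𝕜 := ℂ)).mul_bdd hφ.1.aestronglyMeasurable
      (ae_of_all _ hφ.norm_le)
  · have : Continuous (gaussianPDFReal 0 v) := by
      rw [gaussianPDFReal_def]; fun_prop
    have := hφ.1
    fun_prop
  -- The Fourier kernel is a character, so its product with `φ` is again positive definite.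
  · have h := ((exp_mul_I (-2 * Real.pi * ξ)).mul hφ).integral_gaussianReal_nonneg v
    rw [integral_gaussianReal_eq_integral_smul hv] at h
    rw [Real.fourier_real_eq_integral_exp_smul]
    refine h.trans_eq (integral_congr_ae (ae_of_all _ fun x => ?_))
    have he : Complex.exp ((-2 * Real.pi * ξ : ℝ) * x * Complex.I) =
        Complex.exp ((-2 * Real.pi * x * ξ : ℝ) * Complex.I) := by
      congr 1
      push_cast
      ring
    simp only [Complex.real_smul, smul_eq_mul, he]
    ring

/-- **Bochner's theorem**, for functions with value `1` at `0`. -/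
theorem exists_charFun_eq_of_apply_zero (hφ : IsPositiveDefiniteFun φ) (h0 : φ 0 = 1) :
    ∃ μ : Measure ℝ, IsProbabilityMeasure μ ∧ MeasureTheory.charFun μ = φ := by
  -- The Gaussian density of variance `n + 1`, rescaled to be `1` at `0` so that the measures have
  -- mass one; it tends to `1` pointwise.
  let E : ℕ → ℝ → ℝ := fun n x => Real.exp (-x ^ 2 / (2 * ((n : ℝ) + 1)))
  have key (n : ℕ) : ∃ μ : Measure ℝ, IsProbabilityMeasure μ ∧
      MeasureTheory.charFun μ = fun x => (E n x : ℂ) * φ x := by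
    have hv : (n : ℝ≥0) + 1 ≠ 0 := by positivity
    have hpos : 0 < √(2 * Real.pi * ((n : ℝ) + 1)) := by positivity
    obtain ⟨μ, hμ, h⟩ := (hφ.const_mul (Complex.zero_le_real.2 hpos.le)).exists_charFun_eq_mul_gaussianPDFReal hv
    have h' : MeasureTheory.charFun μ = fun x => (E n x : ℂ) * φ x := by
      rw [h]
      ext x
      rw [gaussianPDFReal_def, ← mul_assoc]
      congr 1
      rw [← Complex.ofReal_mul]
      congr 1
      push_cast
      simp only [sub_zero, E]
      field_simp
    refine ⟨μ, ⟨?_⟩, h'⟩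
    have h1 := congrFun h' 0
    simp only [charFun_zero, E, h0] at h1
    have h2 : μ.real Set.univ = 1 := by simpa using h1
    rwa [measureReal_def, ENNReal.toReal_eq_one_iff] at h2
  choose μ hμ hμφ using key
  have hlim (x : ℝ) : Tendsto (fun n => MeasureTheory.charFun (μ n) x) atTop (𝓝 (φ x)) := by
    simp only [hμφ]
    have h1 : Tendsto (fun n : ℕ => 2 * ((n : ℝ) + 1)) atTop atTop :=
      (tendsto_atTop_add_const_right _ (1 : ℝ) tendsto_natCast_atTop_atTop).const_mul_atTop two_pos
    have h2 : Tendsto (fun n => E n x) atTop (𝓝 1) := by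
      simpa [E, Function.comp_def] using (Real.continuous_exp.tendsto _).comp (h1.const_div_atTop (-x ^ 2))
    simpa using ((Complex.continuous_ofReal.tendsto _).comp h2).mul_const (φ x)
  -- Continuity of the limit at `0` gives tightness, and Prokhorov's theorem a convergent
  -- subsequence.
  have htight := isTightMeasureSet_of_tendsto_charFun hφ.1.continuousAt hlim
  let μ' : ℕ → ProbabilityMeasure ℝ := fun n => ⟨μ n, hμ n⟩
  have hcomp : IsCompact (closure (Set.range μ')) := by
    refine isCompact_closure_of_isTightMeasureSet ?_
    convert htight using 1
    ext ρ
    constructor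
    · rintro ⟨_, ⟨n, rfl⟩, rfl⟩
      exact ⟨n, rfl⟩
    · rintro ⟨n, rfl⟩
      exact ⟨_, ⟨n, rfl⟩, rfl⟩
  obtain ⟨ν, -, θ, hθ, hν⟩ := hcomp.tendsto_subseq fun n => subset_closure (Set.mem_range_self n)
  refine ⟨ν, inferInstance, ?_⟩
  ext x
  exact tendsto_nhds_unique ((ProbabilityMeasure.tendsto_iff_tendsto_charFun.1 hν) x)
    ((hlim x).comp hθ.tendsto_atTop)

/-- **Bochner's theorem** on the real line. -/
theorem exists_charFun_eq (hφ : IsPositiveDefiniteFun φ) :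
    ∃ μ : Measure ℝ, IsFiniteMeasure μ ∧ MeasureTheory.charFun μ = φ := by
  have h0 := hφ.apply_zero_nonneg
  have hre : φ 0 = ((φ 0).re : ℂ) := Complex.eq_re_of_ofReal_le h0
  by_cases hz : φ 0 = 0
  · refine ⟨0, inferInstance, ?_⟩
    ext x
    have := hφ.norm_le x
    rw [hz] at this
    simp [charFun_zero_measure, norm_le_zero_iff.1 this]
  · obtain ⟨μ, hμ, h⟩ := (hφ.const_mul (inv_nonneg.2 h0)).exists_charFun_eq_of_apply_zero
      (inv_mul_cancel₀ hz)
    refine ⟨(φ 0).re.toNNReal • μ, inferInstance, ?_⟩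
    ext x
    have := congrFun h x
    rw [charFun_apply_real] at this ⊢
    rw [integral_smul_nnreal_measure, this, NNReal.smul_def,
      Real.coe_toNNReal _ (Complex.nonneg_iff.1 h0).1, Complex.real_smul, ← hre,
      mul_inv_cancel_left₀ hz]

end IsPositiveDefiniteFun

end Bochner

/-! ### Extension to half planes and factorization of exponentials. -/

section HalfPlane

variable {Φ : ℝ → ℂ}

/-- For `t ≥ 0` and `Im z ≥ 0` one has `|exp (izt)| ≤ 1`, so the defining integral converges at
every such `z`. -/
theorem extendsBoundedHolomorphicUpper_charFun_restrict_Ici (μ : Measure ℝ) [IsFiniteMeasure μ] :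
    ExtendsBoundedHolomorphicUpper (charFun (μ.restrict (Set.Ici 0))) := by
  set ρ := μ.restrict (Set.Ici 0)
  have hpos : ∀ᵐ t ∂ρ, 0 ≤ t := ae_restrict_mem measurableSet_Ici
  have hle (z : ℂ) (hz : 0 ≤ z.im) :
      ∀ᵐ t : ℝ ∂ρ, ‖Complex.exp (Complex.I * z * t)‖ ≤ 1 := by
    filter_upwards [hpos] with t ht
    rw [Complex.norm_exp]
    simpa using mul_nonneg hz ht
  refine ⟨fun z => complexMGF id ρ (Complex.I * z), ?_, ?_, ⟨ρ.real Set.univ, fun z hz => ?_⟩,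
    fun x => ?_⟩
  · refine differentiableOn_complexMGF.comp (by fun_prop) fun z hz => ?_
    have hsub : Set.Iic 0 ⊆ integrableExpSet id ρ := fun s hs => by
      refine Integrable.of_bound (by fun_prop) 1 ?_
      filter_upwards [hpos] with t ht
      rw [Real.norm_eq_abs, Real.abs_exp]
      exact Real.exp_le_one_iff.2 (mul_nonpos_of_nonpos_of_nonneg hs ht)
    refine interior_mono hsub ?_
    rw [interior_Iic]
    simpa using hz
  · exact continuousOn_of_dominated (bound := fun _ => 1) (fun z _ => by fun_prop) hle
      (integrable_const 1) (ae_of_all _ fun t => by fun_prop)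
  · refine (norm_integral_le_of_norm_le (integrable_const (1 : ℝ)) (hle z hz)).trans ?_
    simp
  · change complexMGF id ρ (Complex.I * x) = _
    rw [mul_comm, complexMGF_id_mul_I]

theorem ExtendsBoundedHolomorphicUpper.const_mul_exp (h : ExtendsBoundedHolomorphicUpper Φ)
    (a : ℂ) : ExtendsBoundedHolomorphicUpper fun x => a * Complex.exp (Φ x) := by
  obtain ⟨F, hd, hc, ⟨M, hM⟩, hF⟩ := h
  refine ⟨fun z => a * Complex.exp (F z), hd.cexp.const_mul a, hc.cexp.const_mul a,
    ⟨‖a‖ * Real.exp M, fun z hz => ?_⟩, fun x => by simp only [hF]⟩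
  rw [norm_mul, Complex.norm_exp]
  gcongr
  exact (Complex.re_le_norm _).trans (hM z hz)

theorem ExtendsBoundedHolomorphicUpper.comp_neg (h : ExtendsBoundedHolomorphicUpper Φ) :
    ExtendsBoundedHolomorphicLower fun x => Φ (-x) := by
  obtain ⟨F, hd, hc, ⟨M, hM⟩, hF⟩ := h
  refine ⟨fun z => F (-z), hd.comp (by fun_prop) fun z hz => ?_,
    hc.comp (by fun_prop) fun z hz => ?_, ⟨M, fun z hz => hM _ ?_⟩, fun x => ?_⟩
  · simpa using hz
  · simpa using hz
  · simpa using hz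
  · simp only [← hF, Complex.ofReal_neg]

/-- The exponential of a positive definite function is a product of positive definite functions
that extend to opposite half planes. -/
theorem IsPositiveDefiniteFun.exists_factorization_exp (hΦ : IsPositiveDefiniteFun Φ) {a : ℂ}
    (ha : 0 ≤ a) : ∃ Φp Φm : ℝ → ℂ,
      IsPositiveDefiniteFun Φp ∧ ExtendsBoundedHolomorphicUpper Φp ∧
      IsPositiveDefiniteFun Φm ∧ ExtendsBoundedHolomorphicLower Φm ∧
      ∀ x : ℝ, a * Complex.exp (Φ x) = Φp x * Φm x := by
  obtain ⟨μ, hμ, rfl⟩ := hΦ.exists_charFun_eq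
  -- Reflection `t ↦ -t` reduces the lower half plane to the upper one.
  have hneg (x : ℝ) : MeasureTheory.charFun (μ.restrict (Set.Iio 0)) x =
      MeasureTheory.charFun (((μ.restrict (Set.Iio 0)).map fun t => -1 * t).restrict (Set.Ici 0))
        (-x) := by
    have : ((μ.restrict (Set.Iio 0)).map fun t => -1 * t).restrict (Set.Ici 0) =
        (μ.restrict (Set.Iio 0)).map fun t => -1 * t := by
      refine Measure.restrict_eq_self_of_ae_mem ?_
      refine (ae_map_iff (by fun_prop) (measurableSet_Ici (a := (0 : ℝ)))).2 ?_
      filter_upwards [ae_restrict_mem measurableSet_Iio] with t ht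
      simpa using (Set.mem_Iio.1 ht).le
    rw [this, charFun_map_mul]
    simp
  refine ⟨fun x => a * Complex.exp (MeasureTheory.charFun (μ.restrict (Set.Ici 0)) x),
    fun x => Complex.exp (MeasureTheory.charFun (μ.restrict (Set.Iio 0)) x),
    (charFun _).exp.const_mul ha,
    (extendsBoundedHolomorphicUpper_charFun_restrict_Ici μ).const_mul_exp a,
    (charFun _).exp, ?_, fun x => ?_⟩
  · simpa [hneg] using ((extendsBoundedHolomorphicUpper_charFun_restrict_Ici
      ((μ.restrict (Set.Iio 0)).map fun t => -1 * t)).const_mul_exp 1).comp_neg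
  · rw [mul_assoc, ← Complex.exp_add]
    congr 2
    have hint (s : Set ℝ) : Integrable (fun t : ℝ => Complex.exp (x * t * Complex.I))
        (μ.restrict s) := by
      refine Integrable.of_bound (by fun_prop) 1 (ae_of_all _ fun t => ?_)
      rw [← Complex.ofReal_mul, Complex.norm_exp_ofReal_mul_I]
    simp only [charFun_apply_real]
    rw [← integral_add_measure (hint _) (hint _), ← Set.compl_Ici,
      Measure.restrict_add_restrict_compl measurableSet_Ici]

end HalfPlane

/-! ### Continuity, limit and positive definiteness of the logarithm. -/

section Logarithm

variable {g : ℝ → ℂ}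

/-- A real function `θ` is continuous as soon as all the functions `exp (i r θ)` are. -/
theorem continuous_of_forall_continuous_exp {θ : ℝ → ℝ}
    (h : ∀ r : ℝ, 0 < r → Continuous fun x => Complex.exp (r * θ x * Complex.I)) :
    Continuous θ := by
  have hall (r : ℝ) : Continuous fun x => Complex.exp (r * θ x * Complex.I) := by
    rcases lt_trichotomy r 0 with hr | rfl | hr
    · convert Complex.continuous_conj.comp (h (-r) (neg_pos.2 hr)) using 2 with x
      simp [← Complex.exp_conj]
    · simpa using continuous_const
    · exact h r hr
  refine continuous_iff_seqContinuous.2 fun u x hu => ?_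
  -- The exponentials are the characteristic functions of Dirac masses; by Lévy's theorem these
  -- converge weakly, hence so do their locations.
  have hdir : Tendsto (fun n => diracProba (θ (u n))) atTop (𝓝 (diracProba (θ x))) := by
    rw [ProbabilityMeasure.tendsto_iff_tendsto_charFun]
    intro t
    have := ((hall t).tendsto x).comp hu
    simpa [diracProba, charFun_dirac, Function.comp_def, mul_comm] using this
  have := (tendsto_diracProba_iff_tendsto (map (θ ∘ u) atTop)).1
    (by simpa [Tendsto, Function.comp_def, Filter.map_map] using hdir)
  simpa using! this

/-- The branch `g` is not assumed continuous: a jump by `2πi` would be invisible at `r = 1`, but not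
for all `r`. -/
theorem continuous_of_forall_continuous_exp_mul
    (h : ∀ r : ℝ, 0 < r → Continuous fun x => Complex.exp ((r : ℂ) * g x)) : Continuous g := by
  have hre : Continuous fun x => (g x).re := by
    have h1 := (h 1 one_pos).norm.log fun x => by simp
    simpa [Complex.norm_exp] using h1
  have him : Continuous fun x => (g x).im := by
    refine continuous_of_forall_continuous_exp fun r hr => ?_
    have h1 : Continuous fun x => Complex.exp (-(r * (g x).re : ℝ)) := by fun_prop
    refine (h1.mul (h r hr)).congr fun x => ?_
    rw [Pi.mul_apply, ← Complex.exp_add]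
    congr 1
    push_cast
    linear_combination -(r : ℂ) * Complex.re_add_im (g x)
  exact ((Complex.continuous_ofReal.comp hre).add
    ((Complex.continuous_ofReal.comp him).mul_const Complex.I)).congr fun x =>
      Complex.re_add_im (g x)

/-- A continuous logarithm of a function with a nonzero limit at `+∞` converges at `+∞`. -/
theorem exists_tendsto_of_tendsto_exp (hg : Continuous g) {k : ℂ} (hk : k ≠ 0)
    (h : Tendsto (fun x => Complex.exp (g x)) atTop (𝓝 k)) : ∃ l, Tendsto g atTop (𝓝 l) := by
  have hslit : ∀ᶠ x in atTop, Complex.exp (g x) / k ∈ Complex.slitPlane := by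
    have h1 : Tendsto (fun x => Complex.exp (g x) / k) atTop (𝓝 1) := by
      simpa [hk] using h.div_const k
    exact h1.eventually (Complex.isOpen_slitPlane.mem_nhds Complex.one_mem_slitPlane)
  obtain ⟨X, hX⟩ := eventually_atTop.1 hslit
  -- A principal branch shifted to agree with `g` at `X`. Both lift the same function through the
  -- covering `exp`, so they agree on `[X, ∞)`.
  let G : ℝ → ℂ := fun x =>
    Complex.log (Complex.exp (g x) / k) + (g X - Complex.log (Complex.exp (g X) / k))
  have hGc : ContinuousOn G (Set.Ici X) := by
    refine ContinuousOn.add (ContinuousOn.clog (by fun_prop) fun x hx => hX x hx) continuousOn_const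
  have heq : Set.EqOn g G (Set.Ici X) := by
    refine Complex.isCoveringMap_exp.eqOn_of_comp_eqOn isPreconnected_Ici hg.continuousOn hGc
      (fun x _ => Subtype.ext ?_) Set.self_mem_Ici (by simp [G])
    have h0 (y : ℝ) : Complex.exp (g y) / k ≠ 0 := div_ne_zero (Complex.exp_ne_zero _) hk
    simp only [Function.comp_apply, G]
    rw [Complex.exp_add, Complex.exp_sub, Complex.exp_log (h0 x), Complex.exp_log (h0 X)]
    have := Complex.exp_ne_zero (g X)
    field_simp
  refine ⟨Complex.log 1 + (g X - Complex.log (Complex.exp (g X) / k)), ?_⟩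
  refine Tendsto.congr' (f₁ := G) ?_ (Tendsto.add_const _ ?_)
  · filter_upwards [eventually_ge_atTop X] with x hx using (heq hx).symm
  · refine Tendsto.clog ?_ Complex.one_mem_slitPlane
    simpa [hk] using h.div_const k

/-- If `exp (r g)` is positive definite for all `r > 0` and `g` converges at `+∞`, then `g` is a
positive definite function plus a real constant. -/
theorem IsPositiveDefiniteFun.exists_sub_const
    (hpow : ∀ r : ℝ, 0 < r → IsPositiveDefiniteFun fun x => Complex.exp ((r : ℂ) * g x))
    {l : ℂ} (hl : Tendsto g atTop (𝓝 l)) :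
    ∃ m : ℝ, IsPositiveDefiniteFun fun x => g x - m := by
  have hg := continuous_of_forall_continuous_exp_mul fun r hr => (hpow r hr).1
  have hder (w : ℂ) : Tendsto (fun r : ℝ => (r⁻¹ : ℝ) * (Complex.exp (r * w) - 1)) (𝓝[>] 0)
      (𝓝 w) := by
    have h1 : HasDerivAt (fun r : ℝ => Complex.exp (r * w)) w 0 := by
      simpa using (((hasDerivAt_id (0 : ℝ)).ofReal_comp.mul_const w).cexp)
    have h2 := (hasDerivAt_iff_tendsto_slope.1 h1).mono_left (nhdsGT_le_nhdsNE (0 : ℝ))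
    refine h2.congr fun r => ?_
    simp [slope]
  have hneg (x : ℝ) : g (-x) = conj (g x) := by
    refine tendsto_nhds_unique (hder (g (-x)))
      (((Complex.continuous_conj.tendsto _).comp (hder (g x))).congr' ?_)
    filter_upwards [self_mem_nhdsWithin] with r hr
    simp [(hpow r hr).apply_neg x]
  have hbot : Tendsto g atBot (𝓝 (conj l)) := by
    refine (((Complex.continuous_conj.tendsto _).comp hl).comp tendsto_neg_atBot_atTop).congr
      fun x => ?_
    simp [hneg]
  -- The `-1` of the difference quotients `hder` cancels, leaving `g x - (l + conj l) / 2` in the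
  -- limit.
  refine ⟨l.re, of_tendsto (l := 𝓝[>] (0 : ℝ)) (F := fun r x => (r⁻¹ : ℝ) *
    (Complex.exp (r * g x) - (Complex.exp (r * l) + Complex.exp (r * conj l)) / 2)) ?_
    (hg.sub continuous_const) fun x => ?_⟩
  · filter_upwards [self_mem_nhdsWithin] with r hr
    refine ((hpow r hr).sub_half_add_limits ?_ ?_).const_mul
      (Complex.zero_le_real.2 (inv_nonneg.2 (le_of_lt hr)))
    · exact (hl.const_mul _).cexp
    · exact (hbot.const_mul _).cexp
  · have h1 := (hder (g x)).sub (((hder l).add (hder (conj l))).div_const 2)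
    have h2 : (l + conj l) / 2 = l.re := by
      rw [Complex.add_conj]; push_cast; ring
    rw [h2] at h1
    refine h1.congr fun r => ?_
    ring

end Logarithm

/-- A uniformly continuous function in `L²` vanishes at `+∞`. -/
theorem UniformContinuous.tendsto_atTop_zero_of_memLp_two {u : ℝ → ℂ} (hu : UniformContinuous u)
    (h2 : MemLp u 2 volume) : Tendsto u atTop (𝓝 0) := by
  have hint : Integrable fun x => ‖u x‖ ^ 2 :=
    (memLp_two_iff_integrable_sq_norm hu.continuous.aestronglyMeasurable).1 h2
  rw [Metric.tendsto_atTop]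
  by_contra! hcon
  obtain ⟨ε, hε, hN⟩ := hcon
  obtain ⟨δ, hδ, hδu⟩ := Metric.uniformContinuous_iff.1 hu (ε / 2) (half_pos hε)
  have hI (a b : ℝ) : IntervalIntegrable (fun x => ‖u x‖ ^ 2) volume a b :=
    hint.intervalIntegrable
  have hW := intervalIntegral_tendsto_integral_Ioi 0 hint.integrableOn tendsto_id
  have htail : Tendsto (fun x : ℝ => ∫ y in x..(x + δ / 2), ‖u y‖ ^ 2) atTop (𝓝 0) := by
    have h := (hW.comp (tendsto_atTop_add_const_right atTop (δ / 2) tendsto_id)).sub hW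
    rw [sub_self] at h
    exact h.congr fun x => intervalIntegral.integral_interval_sub_left (hI _ _) (hI _ _)
  have hc : 0 < δ / 2 * (ε / 2) ^ 2 := by positivity
  obtain ⟨N, hN'⟩ := eventually_atTop.1 (htail.eventually_lt_const hc)
  obtain ⟨x, hx, hxε⟩ := hN N
  have hlt := hN' x hx
  rw [intervalIntegral.integral_of_le (by linarith)] at hlt
  -- Where `‖u x‖ ≥ ε`, uniform continuity keeps `‖u‖ ≥ ε / 2` on an interval of length `δ / 2`,
  -- against the vanishing tail of the integral.
  have hlow : δ / 2 * (ε / 2) ^ 2 ≤ ∫ y in Set.Ioc x (x + δ / 2), ‖u y‖ ^ 2 := by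
    have := setIntegral_ge_of_const_le_real (μ := volume) (f := fun y => ‖u y‖ ^ 2)
      (s := Set.Ioc x (x + δ / 2)) (c := (ε / 2) ^ 2) measurableSet_Ioc (by simp) ?_
      hint.integrableOn
    · have hv : volume.real (Set.Ioc x (x + δ / 2)) = δ / 2 := by
        simp [measureReal_def, (half_pos hδ).le]
      rwa [hv, mul_comm] at this
    · intro y hy
      have h1 : dist (u x) (u y) < ε / 2 := hδu (by
        rw [dist_comm, Real.dist_eq, abs_lt]; constructor <;> linarith [hy.1, hy.2])
      rw [dist_zero_right] at hxε
      have h3 : ‖u x‖ ≤ ‖u y‖ + dist (u x) (u y) := by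
        rw [dist_eq_norm]; simpa using norm_add_le (u y) (u x - u y)
      gcongr
      linarith
  exact hlow.not_gt hlt

theorem mainTheorem1 (f g : ℝ → ℂ)
    (hL2 : MemL2AddConst f)
    (hbdd : ∃ M : ℝ, ∀ x : ℝ, ‖f x‖ ≤ M)
    (haway : ∃ c : ℝ, 0 < c ∧ ∀ x : ℝ, c ≤ ‖f x‖)
    (hlog : ∀ x : ℝ, Complex.exp (g x) = f x)
    (hpow : ∀ r : ℝ, 0 < r → IsPositiveDefiniteFun fun x => Complex.exp ((r : ℂ) * g x)) :
    (IsPositiveDefiniteFun f ↔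
      ∃ Φp Φm : ℝ → ℂ,
        IsPositiveDefiniteFun Φp ∧ IsPositiveDefiniteFun Φm ∧ ∀ x : ℝ, f x = Φp x * Φm x) ∧
    (IsPositiveDefiniteFun f →
      ∃ Φp Φm : ℝ → ℂ,
        IsPositiveDefiniteFun Φp ∧ ExtendsBoundedHolomorphicUpper Φp ∧
        IsPositiveDefiniteFun Φm ∧ ExtendsBoundedHolomorphicLower Φm ∧
        ∀ x : ℝ, f x = Φp x * Φm x) := by
  refine ⟨⟨fun hf => ⟨f, fun _ => 1, hf, .one, fun x => by simp⟩, ?_⟩, fun hf => ?_⟩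
  · rintro ⟨Φp, Φm, hp, hm, h⟩
    rw [funext h]
    exact hp.mul hm
  · obtain ⟨k, hk⟩ := hL2
    obtain ⟨c, hc, hcf⟩ := haway
    have hlim : Tendsto f atTop (𝓝 k) := by
      simpa using ((hf.uniformContinuous.sub
        uniformContinuous_const).tendsto_atTop_zero_of_memLp_two hk).add_const k
    have hk0 : k ≠ 0 := norm_pos_iff.1 (hc.trans_le (ge_of_tendsto' hlim.norm hcf))
    have hg := continuous_of_forall_continuous_exp_mul fun r hr => (hpow r hr).1
    obtain ⟨l, hl⟩ := exists_tendsto_of_tendsto_exp hg hk0 (by simpa only [hlog] using hlim)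
    obtain ⟨m, hm⟩ := IsPositiveDefiniteFun.exists_sub_const hpow hl
    obtain ⟨Φp, Φm, h1, h2, h3, h4, h5⟩ :=
      hm.exists_factorization_exp (Complex.zero_le_real.2 (Real.exp_nonneg m))
    refine ⟨Φp, Φm, h1, h2, h3, h4, fun x => ?_⟩
    rw [← h5, Complex.ofReal_exp, ← Complex.exp_add, add_sub_cancel, hlog]
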